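/- Let $L$ be the number of source terminals, $\mathcal S_1,\dots,\mathcal S_L$ finite alphabets, $p(s_1,\dots,s_L)$ a pmf on $\mathcal S_1\times\dots\times\mathcal S_L$, $\varphi:\mathcal S_1\times\dots\times\mathcal S_L\to\mathcal Z$ a function and $d:\mathcal Z\times\hat{\mathcal Z}\to[0,\infty)$ a distortion measure. Let $(S_{1,i},\dots,S_{L,i})$, $i=1,2,\dots$, be i.i.d. with pmf $p$, and $Z_i=\varphi(S_{1,i},\dots,S_{L,i})$. A block code of length $n\ge1$ for the cascade consists of message sets $\mathcal M_0,\dots,\mathcal M_L$ of sizes $M_0=1,M_1,\dots,M_L$, encoders $f_l:\mathcal S_l^n\times\mathcal M_{l-1}\to\mathcal M_l$ for $l=1,\dots,L$, and a decoder $\mathcal M_L\to\hat{\mathcal Z}^n$. Terminal $l$ sends $m_l=f_l(S_l^n,m_{l-1})$ to terminal $l+1$, and terminal $L+1$ outputs $\hat Z^n$ as a function of $m_L$. The rate of link $l$ is $\frac1n\log_2M_l$, and the distortion of the code is $\mathrm E\big[\frac1n\sum_{i=1}^nd(Z_i,\hat Z_i)\big]$. The code is of routing type if, for every $l$, $\mathcal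 M_l$ is identified with $\mathcal M_{l-1}\times\mathcal K_l$ for some finite set $\mathcal K_l$ and $f_l(s,m)=(m,k_l(s,m))$ for some $k_l$: each terminal forwards the received message unchanged, together with a description of its own source that may depend on the received message. For real $D$ let $\mathcal R_{\mathrm{IR}}(D)$ be the set of all $(R_1,\dots,R_L)\in\mathbb R^L$ such that $$R_l\ \ge\ \sum_{i=1}^{l}I(S_i;U_i\mid U_1,\dots,U_{i-1})\ \text{(in bits)},\qquad l=1,\dots,L,$$ for some random variables $U_1,\dots,U_L$ with finite alphabets whose joint pmf with $(S_1,\dots,S_L)$ has the form $p(s_1,\dots,s_L)\prod_{l=1}^Lp(u_l\mid s_l,u_1,\dots,u_{l-1})$, and some function $g$ with $\mathrm E[d(Z,g(U_1,\dots,U_L))]\le D$, where $Z=\varphi(S_1,\dots,S_L)$. Theorem (achievability of the Improved Routing region). Let $(R_1,\dots,R_L)\in\mathcal R_{\mathrm{IR}}(D)$. (1) For every $\varepsilon>0$ and all sufficiently large $n$ there is a code of routing type of length $n$ whose rates are at most $R_l+\varepsilon$, $l=1,\dots,L$, and whose distortion is at most $D+\varepsilon$. (2) If moreover $D>\mathrm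 E[d(Z,h(S_1,\dots,S_L))]$ for some function $h:\mathcal S_1\times\dots\times\mathcal S_L\to\hat{\mathcal Z}$, then $(R_1,\dots,R_L)$ lies in the closure of the set of tuples $(R_1',\dots,R_L')$ for which some code of routing type, of some length $n\ge1$, has rates at most $R_l'$, $l=1,\dots,L$, and distortion at most $D$ (exactly). In particular $(R_1,\dots,R_L)$ lies in the closure of the rate tuples that achieve distortion $D$ on the cascade. -/

import Mathlib

namespace Cascade

/-! ### Information measures on a finite probability space (in bits) -/

open Classical in
/-- `P(X = x)`, for the pmf `P` on the finite set `Ω`. -/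
noncomputable def prob {Ω A : Type*} [Fintype Ω] (P : Ω → ℝ) (X : Ω → A) (x : A) : ℝ :=
  ∑ ω, if X ω = x then P ω else 0

/-- The conditional mutual information
`I(X;Y|W) = E[log₂ (P(X,Y,W) P(W) / (P(X,W) P(Y,W)))]` in bits. -/
noncomputable def condMutualInfo {Ω A B C : Type*} [Fintype Ω] (P : Ω → ℝ)
    (X : Ω → A) (Y : Ω → B) (W : Ω → C) : ℝ :=
  ∑ ω, P ω * Real.logb 2
    (prob P (fun η => (X η, Y η, W η)) (X ω, Y ω, W ω) * prob P W (W ω) /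
      (prob P (fun η => (X η, W η)) (X ω, W ω) * prob P (fun η => (Y η, W η)) (Y ω, W ω)))

/-! ### Block codes for the cascade

Terminals `1, …, L` are indexed by `l : Fin L`. The message sent by terminal `l` has index
`l.succ : Fin (L + 1)`, the one it receives has index `l.castSucc`; message `0` is a dummy with
a single value. -/

/-- A block code of length `n` for the `L`-terminal cascade with source alphabets `S l` and
reconstruction alphabet `Zhat`. -/
structure CascadeCode {L : ℕ} (S : Fin L → Type*) (Zhat : Type*) (n : ℕ) where
  /-- the sizes of the message sets -/
  M : Fin (L + 1) → ℕ
  M_zero : M 0 = 1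
  /-- the encoding functions: terminal `l` maps its source block and the received message to
  the message that it sends -/
  enc : (l : Fin L) → (Fin n → S l) → Fin (M l.castSucc) → Fin (M l.succ)
  /-- the decoder at terminal `L + 1` -/
  dec : Fin (M (Fin.last L)) → Fin n → Zhat

namespace CascadeCode

variable {L : ℕ} {S : Fin L → Type*} {Z Zhat : Type*} {n : ℕ}

/-- The messages produced along the cascade when the source block is `s`. -/
def msg (c : CascadeCode S Zhat n) (s : Fin n → ∀ l, S l) : (j : Fin (L + 1)) → Fin (c.M j) :=
  Fin.induction ⟨0, by simp [c.M_zero]⟩ (fun l m => c.enc l (fun i => s i l) m)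

/-- Every link `l` has rate at most `R l` bits per source symbol. -/
def RatesLE (c : CascadeCode S Zhat n) (R : Fin L → ℝ) : Prop :=
  ∀ l : Fin L, Real.logb 2 (c.M l.succ) / n ≤ R l

/-- The expected per-symbol distortion between `Z_i = φ (S_{1,i}, …, S_{L,i})` and the output of
the code, the source being i.i.d. with pmf `p`. -/
noncomputable def expDistortion [∀ l, Fintype (S l)] (c : CascadeCode S Zhat n)
    (p : (∀ l, S l) → ℝ) (φ : (∀ l, S l) → Z) (d : Z → Zhat → ℝ) : ℝ :=
  ∑ s : Fin n → ∀ l, S l,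
    (∏ i, p (s i)) * ((∑ i, d (φ (s i)) (c.dec (c.msg s (Fin.last L)) i)) / n)

/-- The code is of routing type: the message that a terminal sends is a pair, formed by the
received message, forwarded unchanged, and an index that describes its own source (and may be
chosen as a function of the received message too). -/
def IsRouting (c : CascadeCode S Zhat n) : Prop :=
  ∀ l : Fin L, ∃ (K : ℕ) (e : Fin (c.M l.succ) ≃ Fin (c.M l.castSucc) × Fin K),
    ∀ x m, (e (c.enc l x m)).1 = m

end CascadeCode

section Regions

variable {L : ℕ} {S : Fin L → Type*} [∀ l, Fintype (S l)] {Z Zhat : Type*}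

/-- The rate tuples `R` for which some block code of routing type has rates at most `R` and
expected distortion at most `D`. -/
def routingRates (p : (∀ l, S l) → ℝ) (φ : (∀ l, S l) → Z) (d : Z → Zhat → ℝ) (D : ℝ) :
    Set (Fin L → ℝ) :=
  {R | ∃ n : ℕ, 0 < n ∧ ∃ c : CascadeCode S Zhat n,
    c.IsRouting ∧ c.RatesLE R ∧ c.expDistortion p φ d ≤ D}

/-- The rate tuples `R` such that the rates `R` and the distortion `D` are asymptotically met by
block codes of routing type: up to any `ε > 0`, at all large block lengths. -/
def routingAchievable (p : (∀ l, S l) → ℝ) (φ : (∀ l, S l) → Z) (d : Z → Zhat → ℝ) (D : ℝ) :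
    Set (Fin L → ℝ) :=
  {R | ∀ ε : ℝ, 0 < ε → ∃ N : ℕ, ∀ n ≥ N, ∃ c : CascadeCode S Zhat n,
    c.IsRouting ∧ c.RatesLE (fun l => R l + ε) ∧ c.expDistortion p φ d ≤ D + ε}

/-- The joint pmf `p(s_1,…,s_L) ∏_l q_l(u_l | s_l, u_1,…,u_{l-1})`. -/
noncomputable def jointPmf {U : Fin L → Type*} (p : (∀ l, S l) → ℝ)
    (q : (l : Fin L) → S l → (∀ i : {i // i < l}, U i) → U l → ℝ) :
    (∀ l, S l) × (∀ l, U l) → ℝ :=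
  fun ω => p ω.1 * ∏ l, q l (ω.1 l) (fun i => ω.2 i) (ω.2 l)

/-- The single-letter Improved Routing region: the union, over all finite auxiliary alphabets,
all test channels `q` and all functions `g` with `E[d(Z, g(U_1,…,U_L))] ≤ D`, of the sets
`{R | ∀ l, R_l ≥ ∑_{i ≤ l} I(S_i;U_i|U_1,…,U_{i-1})}`. -/
def irRegion (p : (∀ l, S l) → ℝ) (φ : (∀ l, S l) → Z) (d : Z → Zhat → ℝ) (D : ℝ) :
    Set (Fin L → ℝ) :=
  {R | ∃ (U : Fin L → Type) (_ : ∀ l, Fintype (U l))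
      (q : (l : Fin L) → S l → (∀ i : {i // i < l}, U i) → U l → ℝ)
      (g : (∀ l, U l) → Zhat),
    (∀ l s v, q l s v ∈ stdSimplex ℝ (U l)) ∧
    ∑ ω, jointPmf p q ω * d (φ ω.1) (g ω.2) ≤ D ∧
    ∀ l, ∑ i ∈ Finset.Iic l, condMutualInfo (jointPmf p q)
      (fun ω => ω.1 i) (fun ω => ω.2 i) (fun ω (j : {j // j < i}) => ω.2 j) ≤ R l}

end Regions

end Cascade

/-!
Random coding by rejection sampling. Suppose that both ends of a link know `v` and draw letters
from a common law `r(· | v)`, and that the sender, observing `x`, selects the first letter `b`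
that passes a test of acceptance probability `min (q(b | x, v) / (Γ r(b | v))) 1`. The selected
letter then has a law proportional to `min (q(b | x, v)) (Γ r(b | v))`, and somewhat more than `Γ`
letters suffice for a selection with high probability. So an index of about `log₂ Γ` bits
simulates the test channel `q`, up to the event that its density `q / r` exceeds `Γ`
(`exists_conditional_sampler`).

In the cascade, terminal `l` recovers the letters `u_{<l}` from the received message and
simulates its own test channel with independent randomness. The joint law of sources and
letters is therefore exactly the product of the source law and the laws of the single simulations
(`sum_assemble`), hence almost dominates the law generated by the test channels, restricted to
sequences with small densities. No joint typicality of all sources has to be carried along the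
cascade. Averaging over the randomness gives a deterministic code whose distortion is bounded by
that of the test channels plus a multiple of the probability of large densities
(`exists_cascade_le`).

This is applied to blocks of length `n`, with `r` the conditional law of `U_l` given `U_{<l}`. The
expectation of `log₂ (q / r)` is then `I(S_l; U_l | U_{<l})` (`condMutualInfo_eq`), and an
exponential large deviation bound shows that `Γ = 2 ^ (n (I + η))` suffices
(`exists_routingScheme`).

For distortion exactly `D`, such a scheme with small excess distortion is followed by a much
shorter block in which every terminal describes its source losslessly and the decoder uses `h`;
the slack `D - E[d(Z, h(S))]` on the short block outweighs the excess
(`RoutingScheme.concat`, `RoutingScheme.lossless`).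
-/

namespace Cascade

/-! ### Averages over independent finite random variables -/

theorem exists_le_of_weighted_sum_le {W : Type*} [Fintype W] {ν : W → ℝ}
    (hν : ν ∈ stdSimplex ℝ W) {cost : W → ℝ} {x : ℝ} (h : ∑ w, ν w * cost w ≤ x) :
    ∃ w, cost w ≤ x := by
  by_contra! hlt
  have h1 : ∑ w, ν w * (cost w - x) ≤ 0 := by
    simp only [mul_sub, Finset.sum_sub_distrib, ← Finset.sum_mul, hν.2]
    linarith
  have h2 : ∀ w ∈ Finset.univ, 0 ≤ ν w * (cost w - x) := fun w _ =>
    mul_nonneg (hν.1 w) (sub_nonneg.2 (hlt w).le)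
  have h3 := (Finset.sum_eq_zero_iff_of_nonneg h2).1 (le_antisymm h1 (Finset.sum_nonneg h2))
  have h4 : ∑ w, ν w = 0 := Finset.sum_eq_zero fun w hw => by
    have := h3 w hw
    rcases mul_eq_zero.1 this with h | h
    · exact h
    · exact absurd h (sub_pos.2 (hlt w)).ne'
  rw [hν.2] at h4
  exact one_ne_zero h4

theorem prod_mem_stdSimplex {ι : Type*} [Fintype ι] [DecidableEq ι] {W : ι → Type*}
    [∀ i, Fintype (W i)] {ν : ∀ i, W i → ℝ} (hν : ∀ i, ν i ∈ stdSimplex ℝ (W i)) :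
    (fun w : ∀ i, W i => ∏ i, ν i (w i)) ∈ stdSimplex ℝ (∀ i, W i) := by
  refine ⟨fun w => Finset.prod_nonneg fun i _ => (hν i).1 _, ?_⟩
  rw [← Fintype.prod_sum]
  exact Finset.prod_eq_one fun i _ => (hν i).2

/-- Under a product pmf, a coordinate may be resampled independently of the others. -/
theorem sum_prod_update {ι : Type*} [Fintype ι] [DecidableEq ι] {W : ι → Type*}
    [∀ i, Fintype (W i)] {ν : ∀ i, W i → ℝ} (l : ι) (hν : ∑ x, ν l x = 1)
    (F : (∀ i, W i) → ℝ) :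
    ∑ w, (∏ i, ν i (w i)) * F w =
      ∑ w, (∏ i, ν i (w i)) * ∑ x, ν l x * F (Function.update w l x) := by
  let e := (Equiv.piSplitAt l W).symm
  have hl : ∀ y, e y l = y.1 := fun y => by simp [e]
  have hne : ∀ y i (h : i ≠ l), e y i = y.2 ⟨i, h⟩ := fun y i h => by simp [e, h]
  have hu : ∀ y z x, Function.update (e (y, z)) l x = e (x, z) := fun y z x => by
    funext i
    by_cases h : i = l
    · subst h; simp [hl]
    · simp [h, hne]
  have hp : ∀ y z, ∏ i, ν i (e (y, z) i) = ν l y * ∏ i : {i // i ≠ l}, ν i (z i) := fun y z => by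
    rw [Fintype.prod_eq_mul_prod_subtype_ne _ l, hl]
    congr 1
    exact Finset.prod_congr rfl fun i _ => by rw [hne _ _ i.2]
  rw [← e.sum_comp, ← e.sum_comp (fun w => _ * ∑ x, ν l x * F (Function.update w l x)),
    Fintype.sum_prod_type_right, Fintype.sum_prod_type_right]
  refine Finset.sum_congr rfl fun z _ => ?_
  simp only [hp, hu]
  simp only [mul_assoc]
  rw [← Finset.sum_mul, hν, one_mul, Finset.mul_sum]
  exact Finset.sum_congr rfl fun x _ => by ring

theorem sum_prod_apply {ι : Type*} [Fintype ι] [DecidableEq ι] {W : ι → Type*}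
    [∀ i, Fintype (W i)] {ν : ∀ i, W i → ℝ} (hν : ∀ i, ν i ∈ stdSimplex ℝ (W i)) (l : ι)
    (F : W l → ℝ) :
    ∑ w : ∀ i, W i, (∏ i, ν i (w i)) * F (w l) = ∑ x, ν l x * F x := by
  rw [sum_prod_update l (hν l).2]
  simp only [Function.update_self]
  rw [← Finset.sum_mul, (prod_mem_stdSimplex hν).2, one_mul]

/-! ### Recursion along the cascade -/

section Assemble

variable {L : ℕ} {B : Fin L → Type*}

/-- The tuple `u` determined by `u l = step l (u restricted to the indices below l)`. -/
noncomputable def assemble (step : ∀ l, (∀ i : {i // i < l}, B i) → B l) : ∀ l, B l :=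
  (wellFounded_lt (α := Fin L)).fix fun l u => step l fun i => u i.1 i.2

theorem assemble_apply (step : ∀ l, (∀ i : {i // i < l}, B i) → B l) (l : Fin L) :
    assemble step l = step l fun i => assemble step i :=
  WellFounded.fix_eq _ _ l

theorem eq_assemble_of_le {step : ∀ l, (∀ i : {i // i < l}, B i) → B l} {u : ∀ l, B l} (l : Fin L)
    (h : ∀ i ≤ l, u i = step i fun j => u j) : u l = assemble step l := by
  induction l using WellFoundedLT.induction with
  | ind l ih =>
    rw [h l le_rfl, assemble_apply]
    congr 1
    funext i
    exact ih i i.2 fun j hj => h j (hj.trans i.2.le)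

theorem eq_assemble_iff {step : ∀ l, (∀ i : {i // i < l}, B i) → B l} {u : ∀ l, B l} :
    u = assemble step ↔ ∀ l, u l = step l fun j => u j := by
  constructor
  · rintro rfl l
    exact assemble_apply step l
  · intro h
    funext l
    exact eq_assemble_of_le l fun i _ => h i

theorem assemble_congr_of_le {step step' : ∀ l, (∀ i : {i // i < l}, B i) → B l} (l : Fin L)
    (h : ∀ i ≤ l, step i = step' i) : assemble step l = assemble step' l :=
  eq_assemble_of_le l fun i hi => by rw [← h i hi, assemble_apply]

open Classical in
/-- If the steps of the recursion use independent random elements `w l`, the resulting tuple has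
the product form law whose factors are the laws of the single steps. -/
theorem sum_assemble [∀ l, Fintype (B l)] {W : Fin L → Type*} [∀ l, Fintype (W l)]
    (ν : ∀ l, W l → ℝ) (σ : ∀ l, W l → (∀ i : {i // i < l}, B i) → B l)
    (G : (∀ l, B l) → ℝ) :
    ∑ w : ∀ l, W l, (∏ l, ν l (w l)) * G (assemble fun l => σ l (w l)) =
      ∑ u : ∀ l, B l, (∏ l, ∑ x, if σ l x (fun i => u i) = u l then ν l x else 0) * G u := by
  simp only [Fintype.prod_sum, Finset.sum_mul]
  rw [Finset.sum_comm]
  refine Finset.sum_congr rfl fun w _ => ?_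
  rw [Finset.sum_eq_single (assemble fun l => σ l (w l))]
  · congr 1
    refine Finset.prod_congr rfl fun l _ => ?_
    rw [if_pos (assemble_apply _ l).symm]
  · intro u _ hu
    rw [Ne, eq_assemble_iff, not_forall] at hu
    obtain ⟨l, hl⟩ := hu
    rw [Finset.prod_eq_zero (Finset.mem_univ l) (if_neg (Ne.symm hl)), zero_mul]
  · simp

open Classical in
/-- The law with kernels `k l` is realised by independent random functions. -/
theorem sum_kernel_eq [∀ l, Fintype (B l)]
    {k : ∀ l, (∀ i : {i // i < l}, B i) → B l → ℝ} (hk : ∀ l v, k l v ∈ stdSimplex ℝ (B l))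
    (G : (∀ l, B l) → ℝ) :
    ∑ u : ∀ l, B l, (∏ i, k i (fun j => u j) (u i)) * G u =
      ∑ w : ∀ i : Fin L, (∀ j : {j // j < i}, B j) → B i, (∏ i, ∏ v, k i v (w i v)) *
        G (assemble w) := by
  rw [sum_assemble (fun i (x : (∀ j : {j // j < i}, B j) → B i) => ∏ v, k i v (x v))
    (fun i x => x) G]
  refine Finset.sum_congr rfl fun u _ => ?_
  congr 1
  refine Finset.prod_congr rfl fun i _ => ?_
  have := sum_prod_apply (ν := k i) (hk i) (fun j => u j) (fun y => if y = u i then 1 else 0)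
  simpa using this.symm

/-- The conditional law of `u l` given the preceding coordinates is the kernel `k l`: the
expectation of `H (u_{<l}, u_l)` does not change if `u_l` is resampled from `k l (u_{<l})`.
The kernels are realised by independent random functions, so that this is the resampling of a
coordinate of a product pmf. -/
theorem sum_kernel_step [∀ l, Fintype (B l)]
    {k : ∀ l, (∀ i : {i // i < l}, B i) → B l → ℝ} (hk : ∀ l v, k l v ∈ stdSimplex ℝ (B l))
    (l : Fin L) (H : (∀ i : {i // i < l}, B i) → B l → ℝ) :
    ∑ u : ∀ l, B l, (∏ i, k i (fun j => u j) (u i)) * H (fun j => u j) (u l) =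
      ∑ u : ∀ l, B l, (∏ i, k i (fun j => u j) (u i)) *
        ∑ x, k l (fun j => u j) x * H (fun j => u j) x := by
  classical
  rw [sum_kernel_eq hk fun u => H (fun j => u j) (u l),
    sum_kernel_eq hk fun u => ∑ x, k l (fun j => u j) x * H (fun j => u j) x,
    sum_prod_update (ν := fun i (x : (∀ j : {j // j < i}, B j) → B i) => ∏ v, k i v (x v)) l
      (prod_mem_stdSimplex (hk l)).2]
  refine Finset.sum_congr rfl fun w _ => ?_
  congr 1
  have hlt : ∀ x, (fun j : {j // j < l} => assemble (Function.update w l x) j) =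
      fun j : {j // j < l} => assemble w j := by
    intro x
    funext j
    refine assemble_congr_of_le _ fun i hi => ?_
    rw [Function.update_of_ne (hi.trans_lt j.2).ne]
  simp only [assemble_apply (Function.update w l _) l, hlt, Function.update_self]
  exact sum_prod_apply (hk l) (fun j : {j // j < l} => assemble w j)
    (fun y => H (fun j => assemble w j) y)

theorem sum_kernel_prod [∀ l, Fintype (B l)]
    {k : ∀ l, (∀ i : {i // i < l}, B i) → B l → ℝ} (hk : ∀ l v, k l v ∈ stdSimplex ℝ (B l)) :
    ∑ u : ∀ l, B l, ∏ i, k i (fun j => u j) (u i) = 1 := by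
  classical
  have h := sum_kernel_eq hk fun _ => 1
  simp only [mul_one] at h
  rw [h]
  exact (prod_mem_stdSimplex fun i => prod_mem_stdSimplex (hk i)).2

end Assemble

/-! ### Simulating a channel by rejection sampling -/

section Sampling

universe u v w

open Classical in
/-- One try of rejection sampling: a letter is drawn from `r` and accepted, for the input `a`,
with probability `min (q a b / (Γ * r b)) 1`. The accept decisions for all inputs are part of the
random element. -/
theorem exists_single_try {A : Type u} {B : Type v} [Fintype A] [Fintype B] (q : A → B → ℝ)
    (hq : ∀ a b, 0 ≤ q a b) {r : B → ℝ} (hr : r ∈ stdSimplex ℝ B) {Γ : ℝ} (hΓ : 1 ≤ Γ) :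
    ∃ ν : B × (A → Bool) → ℝ, ν ∈ stdSimplex ℝ (B × (A → Bool)) ∧
      ∀ a b, ∑ x, (if x.2 a = true ∧ x.1 = b then ν x else 0) = min (q a b) (Γ * r b) / Γ := by
  have hΓ0 : 0 < Γ := by linarith
  let θ : B → A → ℝ := fun b a => min (q a b / (Γ * r b)) 1
  have hθ0 : ∀ b a, 0 ≤ θ b a := fun b a =>
    le_min (div_nonneg (hq a b) (mul_nonneg hΓ0.le (hr.1 b))) zero_le_one
  let bern : B → A → Bool → ℝ := fun b a t => if t then θ b a else 1 - θ b a
  have hbern : ∀ b a, bern b a ∈ stdSimplex ℝ Bool := fun b a => by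
    refine ⟨fun t => ?_, by simp [bern]⟩
    cases t
    · have : θ b a ≤ 1 := min_le_right _ _
      simpa [bern] using this
    · simpa [bern] using hθ0 b a
  refine ⟨fun x => r x.1 * ∏ a, bern x.1 a (x.2 a), ⟨fun x => ?_, ?_⟩, fun a b => ?_⟩
  · exact mul_nonneg (hr.1 _) (Finset.prod_nonneg fun a _ => (hbern _ a).1 _)
  · rw [Fintype.sum_prod_type, ← hr.2]
    refine Finset.sum_congr rfl fun b _ => ?_
    simp only [← Finset.mul_sum, (prod_mem_stdSimplex (hbern b)).2, mul_one]
  · rw [Fintype.sum_prod_type, Finset.sum_eq_single b]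
    · have h := sum_prod_apply (hbern b) a fun t => if t = true then 1 else 0
      have h2 : ∑ y : A → Bool, (if y a = true then ∏ a, bern b a (y a) else 0) = θ b a := by
        simpa [bern] using h
      have h3 : ∑ y : A → Bool, (if y a = true ∧ b = b then r b * ∏ a, bern b a (y a) else 0) =
          r b * θ b a := by
        rw [← h2, Finset.mul_sum]
        exact Finset.sum_congr rfl fun y _ => by simp
      refine h3.trans ?_
      rcases (hr.1 b).eq_or_lt with h0 | h0
      · simp [← h0, min_eq_right (hq a b)]
      · have : r b * θ b a = min (r b * (q a b / (Γ * r b))) (r b * 1) :=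
          (mul_min_of_nonneg _ _ h0.le)
        rw [this, ← min_div_div_right hΓ0.le]
        congr 1 <;> field_simp
    · intro c _ hc
      exact Finset.sum_eq_zero fun y _ => if_neg fun h => hc h.2
    · simp

open Classical in
/-- Rejection sampling with `K` tries. The random element `x` determines a codebook of `K + 1`
letters, the last of which is a dummy for the case that all tries are rejected. The index `f x a`
of the first accepted try depends on the input `a`, and the law of the letter with this index almost dominates `min (q a) (Γ r)`. -/
theorem exists_rejection_sampler {A : Type u} {B : Type v} [Fintype A] [Fintype B]
    (q : A → B → ℝ) (hq : ∀ a, q a ∈ stdSimplex ℝ B) {r : B → ℝ} (hr : r ∈ stdSimplex ℝ B)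
    {Γ : ℝ} (hΓ : 1 ≤ Γ) (K : ℕ) :
    ∃ (W : Type (max u v)) (_ : Fintype W) (ν : W → ℝ) (f : W → A → Fin (K + 1))
      (c : W → Fin (K + 1) → B), ν ∈ stdSimplex ℝ W ∧
      ∀ a b, (1 - (1 - Γ⁻¹) ^ K) * min (q a b) (Γ * r b) ≤
        ∑ x, if c x (f x a) = b then ν x else 0 := by
  have hΓ0 : 0 < Γ := by linarith
  induction K with
  | zero =>
    obtain ⟨b₀⟩ : Nonempty B := by
      by_contra h
      rw [not_nonempty_iff] at h
      simpa using hr.2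
    refine ⟨PUnit, inferInstance, fun _ => 1, fun _ _ => 0, fun _ _ => b₀,
      ⟨fun _ => zero_le_one, by simp⟩, fun a b => ?_⟩
    simp only [pow_zero, sub_self, zero_mul]
    exact Finset.sum_nonneg fun x _ => by split_ifs <;> norm_num
  | succ K ih =>
    obtain ⟨W, _, ν, f, c, hν, hlaw⟩ := ih
    obtain ⟨ν₀, hν₀, hlaw₀⟩ := exists_single_try q (fun a => (hq a).1) hr hΓ
    refine ⟨(B × (A → Bool)) × W, inferInstance, fun x => ν₀ x.1 * ν x.2,
      fun x a => if x.1.2 a = true then 0 else (f x.2 a).succ,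
      fun x => Fin.cons x.1.1 (c x.2), ⟨fun x => mul_nonneg (hν₀.1 _) (hν.1 _), ?_⟩,
      fun a b => ?_⟩
    · rw [Fintype.sum_prod_type, ← hν₀.2]
      refine Finset.sum_congr rfl fun y _ => ?_
      simp only [← Finset.mul_sum, hν.2, mul_one]
    · set m := min (q a b) (Γ * r b) with hm
      set t := ∑ x, if c x (f x a) = b then ν x else 0 with ht
      -- the probability that the try is accepted is at most `1 / Γ`
      have hacc : ∑ y, (if y.2 a = true then ν₀ y else 0) ≤ Γ⁻¹ := by
        have h1 : ∑ y, (if y.2 a = true then ν₀ y else 0) =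
            ∑ b, min (q a b) (Γ * r b) / Γ := by
          simp only [← hlaw₀]
          rw [Finset.sum_comm]
          refine Finset.sum_congr rfl fun y _ => ?_
          by_cases h : y.2 a = true <;> simp [h]
        rw [h1, ← Finset.sum_div, ← one_div, ← (hq a).2]
        gcongr
        exact min_le_left _ _
      have hrej : 1 - Γ⁻¹ ≤ ∑ y, (if y.2 a = true then 0 else ν₀ y) := by
        have : ∑ y, (if y.2 a = true then ν₀ y else 0) +
            ∑ y, (if y.2 a = true then 0 else ν₀ y) = 1 := by
          rw [← hν₀.2, ← Finset.sum_add_distrib]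
          exact Finset.sum_congr rfl fun y _ => by split_ifs <;> simp
        linarith
      have hsplit : (∑ x : (B × (A → Bool)) × W,
          if (Fin.cons x.1.1 (c x.2) : Fin (K + 1 + 1) → B)
            (if x.1.2 a = true then 0 else (f x.2 a).succ) = b then ν₀ x.1 * ν x.2 else 0) =
          m / Γ + (∑ y, (if y.2 a = true then 0 else ν₀ y)) * t := by
        rw [Fintype.sum_prod_type, hm, ← hlaw₀, Finset.sum_mul, ← Finset.sum_add_distrib]
        refine Finset.sum_congr rfl fun y _ => ?_
        by_cases h : y.2 a = true
        · by_cases hb : y.1 = b <;> simp [h, hb, ← Finset.mul_sum, hν.2]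
        · simp [h, ht, Finset.mul_sum]
      rw [hsplit]
      have hi : 0 ≤ 1 - Γ⁻¹ := sub_nonneg.2 (inv_le_one_of_one_le₀ hΓ)
      have hm0 : 0 ≤ m := le_min ((hq a).1 b) (mul_nonneg hΓ0.le (hr.1 b))
      have ht0 : 0 ≤ t := Finset.sum_nonneg fun x _ => by
        split_ifs
        · exact hν.1 x
        · exact le_rfl
      calc (1 - (1 - Γ⁻¹) ^ (K + 1)) * m = m / Γ + (1 - Γ⁻¹) * ((1 - (1 - Γ⁻¹) ^ K) * m) := by
            rw [pow_succ, div_eq_mul_inv]; ring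
        _ ≤ m / Γ + (1 - Γ⁻¹) * t := by gcongr; exact hlaw a b
        _ ≤ _ := by gcongr

open Classical in
/-- The sampler of `exists_rejection_sampler`, independently for all values `y` of a side
information that is known to both sides. -/
theorem exists_conditional_sampler {A : Type u} {B : Type v} {V : Type w} [Fintype A] [Fintype B]
    [Fintype V] (q : A → V → B → ℝ) (hq : ∀ a y, q a y ∈ stdSimplex ℝ B) {r : V → B → ℝ}
    (hr : ∀ y, r y ∈ stdSimplex ℝ B) {Γ : ℝ} (hΓ : 1 ≤ Γ) (K : ℕ) :
    ∃ (W : Type (max u v w)) (_ : Fintype W) (ν : W → ℝ) (f : W → A → V → Fin (K + 1))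
      (c : W → V → Fin (K + 1) → B), ν ∈ stdSimplex ℝ W ∧
      ∀ a y b, (1 - (1 - Γ⁻¹) ^ K) * min (q a y b) (Γ * r y b) ≤
        ∑ x, if c x y (f x a y) = b then ν x else 0 := by
  choose W hW ν f c hν hlaw using fun y =>
    exists_rejection_sampler (fun a => q a y) (fun a => hq a y) (hr y) hΓ K
  refine ⟨∀ y, W y, inferInstance, fun x => ∏ y, ν y (x y), fun x a y => f y (x y) a,
    fun x y => c y (x y), prod_mem_stdSimplex hν, fun a y b => ?_⟩
  refine (hlaw y a b).trans_eq ?_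
  have := sum_prod_apply hν y fun x => if c y x (f y x a) = b then 1 else 0
  simpa using this.symm

end Sampling

/-! ### The one-shot bound for the cascade -/

section OneShot

universe u

variable {L : ℕ} {Ω : Type*} [Fintype Ω] {A : Fin L → Type u} {B : Fin L → Type}
  [∀ l, Fintype (A l)] [∀ l, Fintype (B l)]

open Classical in
/-- Terminal `l` observes `a l ω` and the preceding descriptions `u_{<l}`, and simulates the test
channel `q l` with an index from a set of size `K l + 1`. The loss against the law generated by
the test channels is at most `C` times the probability that some density `q l / r l` exceeds `Γ l`, up
to the small probability `δ` that a sampler rejects all its tries. -/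
theorem exists_cascade_le {P : Ω → ℝ} (hP : P ∈ stdSimplex ℝ Ω) (a : ∀ l, Ω → A l)
    {q : ∀ l, A l → (∀ i : {i // i < l}, B i) → B l → ℝ}
    (hq : ∀ l x v, q l x v ∈ stdSimplex ℝ (B l))
    {r : ∀ l, (∀ i : {i // i < l}, B i) → B l → ℝ} (hr : ∀ l v, r l v ∈ stdSimplex ℝ (B l))
    {Γ : Fin L → ℝ} (hΓ : ∀ l, 1 ≤ Γ l) {K : Fin L → ℕ} {δ : ℝ} (hδ₀ : 0 ≤ δ) (hδ : δ ≤ 1)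
    (hK : ∀ l, (1 - (Γ l)⁻¹) ^ K l ≤ δ) {F : Ω → (∀ l, B l) → ℝ} {C : ℝ}
    (hF0 : ∀ ω u, 0 ≤ F ω u) (hFC : ∀ ω u, F ω u ≤ C) :
    ∃ (f : ∀ l, A l → (∀ i : {i // i < l}, B i) → Fin (K l + 1))
      (c : ∀ l, (∀ i : {i // i < l}, B i) → Fin (K l + 1) → B l),
      ∑ ω, P ω * F ω (assemble fun l v => c l v (f l (a l ω) v)) ≤
        ∑ ω, ∑ u : ∀ l, B l, P ω * (∏ l, q l (a l ω) (fun i => u i) (u l)) * F ω u +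
        C * (1 - (1 - δ) ^ L * ∑ ω, ∑ u : ∀ l, B l,
          if ∀ l, q l (a l ω) (fun i => u i) (u l) ≤ Γ l * r l (fun i => u i) (u l) then
            P ω * ∏ l, q l (a l ω) (fun i => u i) (u l) else 0) := by
  choose W hW ν f c hν hlaw using fun l =>
    exists_conditional_sampler (q l) (hq l) (hr l) (hΓ l) (K l)
  obtain ⟨w, hw⟩ := exists_le_of_weighted_sum_le (prod_mem_stdSimplex hν)
    (le_refl (∑ w : ∀ l, W l, (∏ l, ν l (w l)) *
      ∑ ω, P ω * F ω (assemble fun l v => c l (w l) v (f l (w l) (a l ω) v))))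
  refine ⟨fun l => f l (w l), fun l => c l (w l), hw.trans ?_⟩
  -- the law of the descriptions generated by the random code
  set law : Ω → (∀ l, B l) → ℝ := fun ω u => P ω * ∏ l, ∑ x,
    if c l x (fun i => u i) (f l x (a l ω) fun i => u i) = u l then ν l x else 0 with hlawdef
  set Q : Ω → (∀ l, B l) → ℝ := fun ω u => P ω * ∏ l, q l (a l ω) (fun i => u i) (u l) with hQ
  set T : Ω → (∀ l, B l) → ℝ := fun ω u =>
    if ∀ l, q l (a l ω) (fun i => u i) (u l) ≤ Γ l * r l (fun i => u i) (u l) then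
      Q ω u else 0 with hT
  have hlawF : ∀ G : Ω → (∀ l, B l) → ℝ, ∑ w : ∀ l, W l, (∏ l, ν l (w l)) *
      ∑ ω, P ω * G ω (assemble fun l v => c l (w l) v (f l (w l) (a l ω) v)) =
      ∑ ω, ∑ u, law ω u * G ω u := by
    intro G
    simp only [Finset.mul_sum]
    rw [Finset.sum_comm]
    refine Finset.sum_congr rfl fun ω _ => ?_
    have := sum_assemble ν (fun l x v => c l x v (f l x (a l ω) v)) (G ω)
    simp only [hlawdef, mul_assoc, ← Finset.mul_sum, ← this]
    rw [Finset.mul_sum]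
    exact Finset.sum_congr rfl fun w _ => by ring
  have hlaw1 : ∑ ω, ∑ u, law ω u = 1 := by
    have := hlawF fun _ _ => 1
    simp only [mul_one, hP.2, (prod_mem_stdSimplex hν).2] at this
    exact this.symm
  have hδ0 : 0 ≤ 1 - δ := by linarith
  have hQ0 : ∀ ω u, 0 ≤ Q ω u := fun ω u =>
    mul_nonneg (hP.1 ω) (Finset.prod_nonneg fun l _ => (hq l _ _).1 _)
  have hdom : ∀ ω u, (1 - δ) ^ L * T ω u ≤ law ω u := by
    intro ω u
    by_cases h : ∀ l, q l (a l ω) (fun i => u i) (u l) ≤ Γ l * r l (fun i => u i) (u l)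
    · simp only [hT, if_pos h, hQ, hlawdef]
      have : (1 - δ) ^ L * (P ω * ∏ l, q l (a l ω) (fun i => u i) (u l)) =
          P ω * ∏ l, ((1 - δ) * q l (a l ω) (fun i => u i) (u l)) := by
        rw [Finset.prod_mul_distrib]
        simp
        ring
      rw [this]
      refine mul_le_mul_of_nonneg_left (Finset.prod_le_prod
        (fun l _ => mul_nonneg hδ0 ((hq l _ _).1 _)) fun l _ => ?_) (hP.1 ω)
      refine le_trans ?_ (hlaw l (a l ω) (fun i => u i) (u l))
      rw [min_eq_left (h l)]
      exact mul_le_mul_of_nonneg_right (by linarith [hK l]) ((hq l _ _).1 _)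
    · simp only [hT, if_neg h, mul_zero, hlawdef]
      refine mul_nonneg (hP.1 ω) (Finset.prod_nonneg fun l _ => Finset.sum_nonneg fun x _ => ?_)
      split_ifs
      · exact (hν l).1 x
      · exact le_rfl
  have hTQ : ∀ ω u, (1 - δ) ^ L * T ω u ≤ Q ω u := by
    intro ω u
    have h1 : (1 - δ) ^ L ≤ 1 := pow_le_one₀ hδ0 (by linarith)
    simp only [hT]
    split_ifs
    · exact mul_le_of_le_one_left (hQ0 ω u) h1
    · simpa using hQ0 ω u
  rw [hlawF]
  have hpoint : ∀ ω u, law ω u * F ω u ≤ Q ω u * F ω u +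
      C * (law ω u - (1 - δ) ^ L * T ω u) := by
    intro ω u
    have h1 := mul_le_mul_of_nonneg_right (hTQ ω u) (hF0 ω u)
    have h2 := mul_le_mul_of_nonneg_left (hFC ω u) (sub_nonneg.2 (hdom ω u))
    linarith
  calc ∑ ω, ∑ u, law ω u * F ω u
      ≤ ∑ ω, ∑ u, (Q ω u * F ω u + C * (law ω u - (1 - δ) ^ L * T ω u)) :=
        Finset.sum_le_sum fun ω _ => Finset.sum_le_sum fun u _ => hpoint ω u
    _ = _ := by
        simp only [Finset.sum_add_distrib, ← Finset.mul_sum, Finset.sum_sub_distrib, hlaw1]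
        rfl

end OneShot

/-! ### Routing schemes -/

/-- A routing code in unfolded form: the index of terminal `l` ranges over a set of size `size l`
and depends on its source block and on the tuple of all preceding indices; the decoder receives
the tuple of all indices. -/
structure RoutingScheme {L : ℕ} (S : Fin L → Type*) (Zhat : Type*) (n : ℕ) where
  /-- the number of indices of terminal `l` -/
  size : Fin L → ℕ
  size_pos : ∀ l, 0 < size l
  /-- the index chosen by terminal `l` -/
  enc : ∀ l, (Fin n → S l) → (∀ i : {i // i < l}, Fin (size i)) → Fin (size l)
  /-- the reconstruction from the tuple of all indices -/
  dec : (∀ l, Fin (size l)) → Fin n → Zhat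

namespace RoutingScheme

variable {L : ℕ} {S : Fin L → Type*} {Z Zhat : Type*} {n m : ℕ}

/-- The tuple of all indices for the source block `s`. -/
noncomputable def indices (c : RoutingScheme S Zhat n) (s : Fin n → ∀ l, S l) :
    ∀ l, Fin (c.size l) :=
  assemble fun l v => c.enc l (fun i => s i l) v

theorem indices_apply (c : RoutingScheme S Zhat n) (s : Fin n → ∀ l, S l) (l : Fin L) :
    c.indices s l = c.enc l (fun i => s i l) fun i => c.indices s i :=
  assemble_apply _ l

/-- The expected distortion of the block, summed over its symbols. -/
noncomputable def totalDistortion [∀ l, Fintype (S l)] (c : RoutingScheme S Zhat n)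
    (p : (∀ l, S l) → ℝ) (φ : (∀ l, S l) → Z) (d : Z → Zhat → ℝ) : ℝ :=
  ∑ s : Fin n → ∀ l, S l, (∏ i, p (s i)) * ∑ i, d (φ (s i)) (c.dec (c.indices s) i)

/-- The message with index `j`: the tuple of the indices of the first `j` terminals. -/
abbrev Message (size : Fin L → ℕ) (j : Fin (L + 1)) : Type :=
  ∀ i : {i : Fin L // i.castSucc < j}, Fin (size i)

/-- A message is the preceding message together with one more index. -/
def messageEquiv (size : Fin L → ℕ) (l : Fin L) :
    Message size l.succ ≃ Message size l.castSucc × Fin (size l) where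
  toFun t := (fun i => t ⟨i, i.2.trans Fin.castSucc_lt_succ⟩, t ⟨l, Fin.castSucc_lt_succ⟩)
  invFun y i := if h : i.1 = l then y.2.cast (by rw [h]) else
    y.1 ⟨i, Fin.castSucc_lt_castSucc_iff.2
      (lt_of_le_of_ne (Fin.castSucc_lt_succ_iff.1 i.2) h)⟩
  left_inv t := by
    funext i
    obtain ⟨i, hi⟩ := i
    by_cases h : i = l
    · subst h; simp
    · simp [h]
  right_inv y := by
    refine Prod.ext ?_ (by simp)
    funext i
    have : i.1 ≠ l := (Fin.castSucc_lt_castSucc_iff.1 i.2).ne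
    simp [this]

theorem card_message_succ (size : Fin L → ℕ) (l : Fin L) :
    Fintype.card (Message size l.succ) = ∏ i ∈ Finset.Iic l, size i := by
  simp only [Message, Fintype.card_pi, Fintype.card_fin]
  exact (Finset.prod_subtype (Finset.Iic l) (fun i => by simp [Fin.castSucc_lt_succ_iff])
    size).symm

/-- The code whose messages are the tuples of the indices chosen so far. -/
noncomputable def toCode (c : RoutingScheme S Zhat n) : CascadeCode S Zhat n where
  M j := Fintype.card (Message c.size j)
  M_zero := by
    have : IsEmpty {i : Fin L // i.castSucc < 0} := ⟨fun i => (Fin.not_lt_zero _) i.2⟩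
    exact Fintype.card_unique
  enc l x t := Fintype.equivFin _ ((messageEquiv c.size l).symm ((Fintype.equivFin _).symm t,
    c.enc l x fun i => (Fintype.equivFin (Message c.size l.castSucc)).symm t
      ⟨i, Fin.castSucc_lt_castSucc_iff.2 i.2⟩))
  dec t := c.dec fun l => (Fintype.equivFin (Message c.size (Fin.last L))).symm t
    ⟨l, Fin.castSucc_lt_last l⟩

theorem isRouting_toCode (c : RoutingScheme S Zhat n) : c.toCode.IsRouting := fun l =>
  ⟨c.size l, (Fintype.equivFin (Message c.size l.succ)).symm.trans ((messageEquiv c.size l).trans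
    ((Fintype.equivFin (Message c.size l.castSucc)).prodCongr (Equiv.refl _))),
    fun x t => by
      change (Fintype.equivFin (Message c.size l.castSucc) (messageEquiv c.size l
        ((Fintype.equivFin _).symm (Fintype.equivFin _ ((messageEquiv c.size l).symm _)))).1) = t
      rw [Equiv.symm_apply_apply, Equiv.apply_symm_apply]
      exact Equiv.apply_symm_apply _ t⟩

theorem msg_toCode (c : RoutingScheme S Zhat n) (s : Fin n → ∀ l, S l) (j : Fin (L + 1)) :
    c.toCode.msg s j = Fintype.equivFin (Message c.size j) fun i => c.indices s i := by
  induction j using Fin.induction with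
  | zero =>
    have : IsEmpty {i : Fin L // i.castSucc < 0} := ⟨fun i => (Fin.not_lt_zero _) i.2⟩
    have h : Subsingleton (Fin (c.toCode.M 0)) := by
      rw [c.toCode.M_zero]; infer_instance
    exact h.elim _ _
  | succ l ih =>
    have h : c.toCode.msg s l.succ =
        c.toCode.enc l (fun i => s i l) (c.toCode.msg s l.castSucc) := by
      simp [CascadeCode.msg]
    rw [h, ih]
    simp only [toCode, Equiv.symm_apply_apply]
    congr 1
    rw [Equiv.symm_apply_eq]
    simp only [messageEquiv, Equiv.coe_fn_mk]
    rw [← indices_apply]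

theorem dec_msg_toCode (c : RoutingScheme S Zhat n) (s : Fin n → ∀ l, S l) :
    c.toCode.dec (c.toCode.msg s (Fin.last L)) = c.dec (c.indices s) := by
  rw [msg_toCode]
  simp [toCode]

theorem expDistortion_toCode [∀ l, Fintype (S l)] (c : RoutingScheme S Zhat n)
    (p : (∀ l, S l) → ℝ) (φ : (∀ l, S l) → Z) (d : Z → Zhat → ℝ) :
    c.toCode.expDistortion p φ d = c.totalDistortion p φ d / n := by
  simp only [CascadeCode.expDistortion, totalDistortion, dec_msg_toCode, Finset.sum_div,
    mul_div_assoc]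

theorem ratesLE_toCode (c : RoutingScheme S Zhat n) (hn : 0 < n) {R : Fin L → ℝ}
    (h : ∀ l, ∑ i ∈ Finset.Iic l, Real.logb 2 (c.size i) ≤ n * R l) : c.toCode.RatesLE R := by
  intro l
  have h1 : c.toCode.M l.succ = ∏ i ∈ Finset.Iic l, c.size i := card_message_succ c.size l
  rw [h1, div_le_iff₀' (by exact_mod_cast hn), Nat.cast_prod, Real.logb_prod]
  · exact h l
  · exact fun i _ => by exact_mod_cast (c.size_pos i).ne'

/-- Two schemes used one after the other on consecutive blocks. -/
noncomputable def concat (c : RoutingScheme S Zhat n) (c' : RoutingScheme S Zhat m) :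
    RoutingScheme S Zhat (n + m) where
  size l := c.size l * c'.size l
  size_pos l := Nat.mul_pos (c.size_pos l) (c'.size_pos l)
  enc l x v := finProdFinEquiv
    (c.enc l (fun i => x (Fin.castAdd m i)) fun i => (finProdFinEquiv.symm (v i)).1,
      c'.enc l (fun i => x (Fin.natAdd n i)) fun i => (finProdFinEquiv.symm (v i)).2)
  dec t := Fin.append (c.dec fun l => (finProdFinEquiv.symm (t l)).1)
    (c'.dec fun l => (finProdFinEquiv.symm (t l)).2)

theorem indices_concat (c : RoutingScheme S Zhat n) (c' : RoutingScheme S Zhat m)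
    (s : Fin n → ∀ l, S l) (s' : Fin m → ∀ l, S l) :
    (c.concat c').indices (Fin.append s s') =
      fun l => finProdFinEquiv (c.indices s l, c'.indices s' l) := by
  symm
  refine eq_assemble_iff.2 fun l => ?_
  simp only [concat, Equiv.symm_apply_apply, Fin.append_left, Fin.append_right, ← indices_apply]

theorem totalDistortion_concat [∀ l, Fintype (S l)] (c : RoutingScheme S Zhat n)
    (c' : RoutingScheme S Zhat m) {p : (∀ l, S l) → ℝ} (hp : p ∈ stdSimplex ℝ (∀ l, S l))
    (φ : (∀ l, S l) → Z) (d : Z → Zhat → ℝ) :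
    (c.concat c').totalDistortion p φ d =
      c.totalDistortion p φ d + c'.totalDistortion p φ d := by
  have hn : ∀ k : ℕ, ∑ s : Fin k → ∀ l, S l, ∏ i, p (s i) = 1 := fun k =>
    (prod_mem_stdSimplex fun _ : Fin k => hp).2
  have hdec : ∀ s s', (c.concat c').dec ((c.concat c').indices (Fin.append s s')) =
      Fin.append (c.dec (c.indices s)) (c'.dec (c'.indices s')) := fun s s' => by
    rw [indices_concat]
    simp [concat]
  unfold totalDistortion
  rw [← (Fin.appendEquiv n m).sum_comp, Fintype.sum_prod_type]
  simp only [Fin.appendEquiv, Equiv.coe_fn_mk, hdec, Fin.prod_univ_add, Fin.sum_univ_add,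
    Fin.append_left, Fin.append_right, mul_add, Finset.sum_add_distrib]
  congr 1
  · refine Finset.sum_congr rfl fun s _ => ?_
    rw [← Finset.sum_mul, ← Finset.mul_sum, hn, mul_one]
  · rw [Finset.sum_comm]
    refine Finset.sum_congr rfl fun s _ => ?_
    rw [← Finset.sum_mul, ← Finset.sum_mul, hn, one_mul]

/-- Every terminal describes its whole source block, and the reconstruction is the function `h` of
the source symbols. -/
noncomputable def lossless [∀ l, Fintype (S l)] [∀ l, Nonempty (S l)] (h : (∀ l, S l) → Zhat)
    (n : ℕ) : RoutingScheme S Zhat n where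
  size l := by classical exact Fintype.card (Fin n → S l)
  size_pos l := Fintype.card_pos
  enc l x _ := by classical exact Fintype.equivFin _ x
  dec t i := h fun l => by classical exact (Fintype.equivFin (Fin n → S l)).symm (t l) i

theorem totalDistortion_lossless [∀ l, Fintype (S l)] [∀ l, Nonempty (S l)]
    (h : (∀ l, S l) → Zhat) {p : (∀ l, S l) → ℝ} (hp : p ∈ stdSimplex ℝ (∀ l, S l))
    (φ : (∀ l, S l) → Z) (d : Z → Zhat → ℝ) :
    (lossless h n).totalDistortion p φ d = n * ∑ s, p s * d (φ s) (h s) := by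
  have h1 : ∀ s : Fin n → ∀ l, S l, (lossless h n).dec ((lossless h n).indices s) =
      fun i => h (s i) := fun s => by
    have h2 : (lossless h n).indices s = fun l => Fintype.equivFin _ fun i => s i l :=
      funext fun l => indices_apply _ s l
    rw [h2]
    funext i
    simp [lossless]
  simp only [totalDistortion, h1, Finset.mul_sum]
  rw [Finset.sum_comm]
  have h3 := fun i : Fin n => sum_prod_apply (fun _ : Fin n => hp) i fun s => d (φ s) (h s)
  simp only [h3, Finset.sum_const, Finset.card_univ, Fintype.card_fin, nsmul_eq_mul,
    Finset.mul_sum]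

theorem logb_size_lossless [∀ l, Fintype (S l)] [∀ l, Nonempty (S l)]
    (h : (∀ l, S l) → Zhat) (l : Fin L) :
    Real.logb 2 ((lossless h n).size l) = n * Real.logb 2 (Fintype.card (S l)) := by
  simp [lossless, Real.logb_pow]

/-- A scheme from encoders that use the decoded letters `u_{<l}` as side information instead of
the preceding indices: the preceding indices determine these letters. -/
theorem exists_of_codebooks {B : Fin L → Type*} {size : Fin L → ℕ} (hsize : ∀ l, 0 < size l)
    (f : ∀ l, (Fin n → S l) → (∀ i : {i // i < l}, B i) → Fin (size l))
    (c : ∀ l, (∀ i : {i // i < l}, B i) → Fin (size l) → B l) (g : (∀ l, B l) → Fin n → Zhat) :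
    ∃ σ : RoutingScheme S Zhat n, σ.size = size ∧ ∀ s, σ.dec (σ.indices s) =
      g (assemble fun l v => c l v (f l (fun i => s i l) v)) := by
  let letters : (∀ l, Fin (size l)) → ∀ l, B l := fun t => assemble fun l v => c l v (t l)
  let extend : ∀ l, (∀ i : {i // i < l}, Fin (size i)) → ∀ i, Fin (size i) :=
    fun l v i => if h : i < l then v ⟨i, h⟩ else ⟨0, hsize i⟩
  let σ : RoutingScheme S Zhat n :=
    { size := size
      size_pos := hsize
      enc := fun l x v => f l x fun i => letters (extend l v) i
      dec := fun t => g (letters t) }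
  refine ⟨σ, rfl, fun s => ?_⟩
  change g (letters (σ.indices s)) = _
  congr 1
  refine eq_assemble_iff.2 fun l => ?_
  have h1 : letters (σ.indices s) l =
      c l (fun i => letters (σ.indices s) i) (σ.indices s l) := assemble_apply _ l
  have h2 : σ.indices s l = f l (fun i => s i l)
      fun i => letters (extend l fun i => σ.indices s i) i := σ.indices_apply s l
  rw [h1, h2]
  congr 2
  funext i
  refine assemble_congr_of_le _ fun j hj => ?_
  have : j < l := hj.trans_lt i.2
  simp [extend, this]

end RoutingScheme

/-! ### An exponential large deviation bound -/

theorem exists_large_deviation_bound {Ω : Type*} [Fintype Ω] {Q : Ω → ℝ}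
    (hQ : Q ∈ stdSimplex ℝ Ω) (Y : Ω → ℝ) (hY : ∑ ω, Q ω * Y ω < 0) :
    ∃ c : ℝ, 0 ≤ c ∧ c < 1 ∧ ∀ n : ℕ,
      ∑ ω : Fin n → Ω, (if 0 < ∑ i, Y (ω i) then ∏ i, Q (ω i) else 0) ≤ c ^ n := by
  -- the moment generating function is `1` at `0`, with negative derivative there
  have hderiv : HasDerivAt (fun t => ∑ ω, Q ω * Real.exp (t * Y ω)) (∑ ω, Q ω * Y ω) 0 := by
    refine HasDerivAt.fun_sum fun ω _ => ?_
    have h := (((hasDerivAt_id (0 : ℝ)).mul_const (Y ω)).exp).const_mul (Q ω)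
    simpa using h
  have hslope := (hasDerivAt_iff_tendsto_slope.1 hderiv).eventually_lt_const hY
  obtain ⟨t, ht, ht0⟩ : ∃ t, slope (fun t => ∑ ω, Q ω * Real.exp (t * Y ω)) 0 t < 0 ∧
      (0 : ℝ) < t :=
    ((hslope.filter_mono (nhdsWithin_mono (s := Set.Ioi 0) _ fun x hx => (Set.mem_Ioi.1 hx).ne')).and
      (self_mem_nhdsWithin (s := Set.Ioi (0 : ℝ)))).exists
  have hlt : ∑ ω, Q ω * Real.exp (t * Y ω) < 1 := by
    rw [slope_def_field, div_neg_iff] at ht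
    simp only [zero_mul, Real.exp_zero, mul_one, hQ.2, sub_zero] at ht
    rcases ht with h | h
    · linarith [h.2]
    · linarith [h.1]
  refine ⟨∑ ω, Q ω * Real.exp (t * Y ω), Finset.sum_nonneg fun ω _ =>
    mul_nonneg (hQ.1 ω) (Real.exp_pos _).le, hlt, fun n => ?_⟩
  have hpow : (∑ ω, Q ω * Real.exp (t * Y ω)) ^ n =
      ∑ ω : Fin n → Ω, ∏ i, Q (ω i) * Real.exp (t * Y (ω i)) := by
    rw [← Fintype.prod_sum (fun (_ : Fin n) ω => Q ω * Real.exp (t * Y ω))]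
    simp
  rw [hpow]
  refine Finset.sum_le_sum fun ω _ => ?_
  have h0 : 0 ≤ ∏ i, Q (ω i) := Finset.prod_nonneg fun i _ => hQ.1 _
  rw [Finset.prod_mul_distrib, ← Real.exp_sum, ← Finset.mul_sum]
  split_ifs with h
  · exact le_mul_of_one_le_right h0 (Real.one_le_exp (mul_pos ht0 h).le)
  · exact mul_nonneg h0 (Real.exp_pos _).le

/-! ### The information densities of the test channels -/

section Prob

variable {Ω A C : Type*} [Fintype Ω] {Q : Ω → ℝ}

theorem prob_nonneg (hQ : ∀ ω, 0 ≤ Q ω) (X : Ω → A) (x : A) : 0 ≤ prob Q X x :=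
  Finset.sum_nonneg fun ω _ => by
    split_ifs
    · exact hQ ω
    · exact le_rfl

theorem prob_pos (hQ : ∀ ω, 0 ≤ Q ω) (X : Ω → A) {ω : Ω} (hω : 0 < Q ω) :
    0 < prob Q X (X ω) := by
  classical
  refine hω.trans_le ?_
  have h := Finset.single_le_sum (f := fun η => if X η = X ω then Q η else 0)
    (fun η _ => by split_ifs; exacts [hQ η, le_rfl]) (Finset.mem_univ ω)
  simp only [if_true] at h
  unfold prob
  convert h

theorem sum_prob_prodMk [Fintype A] (X : Ω → A) (V : Ω → C) (v : C) :
    ∑ x, prob Q (fun ω => (X ω, V ω)) (x, v) = prob Q V v := by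
  classical
  unfold prob
  rw [Finset.sum_comm]
  refine Finset.sum_congr rfl fun ω _ => ?_
  by_cases h : V ω = v <;> simp [h]

/-- A version of the conditional law of `X` given `V`. -/
theorem exists_condKernel [Fintype A] [Nonempty A] (hQ : ∀ ω, 0 ≤ Q ω) (X : Ω → A) (V : Ω → C) :
    ∃ r : C → A → ℝ, (∀ v, r v ∈ stdSimplex ℝ A) ∧
      ∀ v x, prob Q V v * r v x = prob Q (fun ω => (X ω, V ω)) (x, v) := by
  classical
  refine ⟨fun v => if prob Q V v = 0 then Pi.single (Classical.arbitrary A) 1 else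
    fun x => prob Q (fun ω => (X ω, V ω)) (x, v) / prob Q V v, fun v => ?_, fun v x => ?_⟩
  · beta_reduce
    split_ifs with h
    · exact single_mem_stdSimplex ℝ _
    · refine ⟨fun x => div_nonneg (prob_nonneg hQ _ _) (prob_nonneg hQ _ _), ?_⟩
      rw [← Finset.sum_div, sum_prob_prodMk, div_self h]
  · beta_reduce
    split_ifs with h
    · rw [h, zero_mul]
      rw [← sum_prob_prodMk X] at h
      exact ((Finset.sum_eq_zero_iff_of_nonneg fun x _ => prob_nonneg hQ _ _).1 h x
        (Finset.mem_univ x)).symm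
    · exact mul_div_cancel₀ _ h

end Prob

section TestChannel

variable {L : ℕ} {S : Fin L → Type*} [∀ l, Fintype (S l)] {U : Fin L → Type*}
  [∀ l, Fintype (U l)] {p : (∀ l, S l) → ℝ}
  {q : (l : Fin L) → S l → (∀ i : {i // i < l}, U i) → U l → ℝ}

theorem jointPmf_mem_stdSimplex (hp : p ∈ stdSimplex ℝ (∀ l, S l))
    (hq : ∀ l s v, q l s v ∈ stdSimplex ℝ (U l)) :
    jointPmf p q ∈ stdSimplex ℝ ((∀ l, S l) × (∀ l, U l)) := by
  refine ⟨fun ω => mul_nonneg (hp.1 _) (Finset.prod_nonneg fun l _ => (hq l _ _).1 _), ?_⟩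
  rw [Fintype.sum_prod_type, ← hp.2]
  refine Finset.sum_congr rfl fun s _ => ?_
  have h := sum_kernel_prod (k := fun l => q l (s l)) fun l v => hq l (s l) v
  simp only [jointPmf, ← Finset.mul_sum, h, mul_one]

theorem sum_jointPmf_step (hq : ∀ l s v, q l s v ∈ stdSimplex ℝ (U l)) (l : Fin L)
    (H : S l → (∀ i : {i // i < l}, U i) → U l → ℝ) :
    ∑ ω, jointPmf p q ω * H (ω.1 l) (fun i => ω.2 i) (ω.2 l) =
      ∑ ω, jointPmf p q ω * ∑ x, q l (ω.1 l) (fun i => ω.2 i) x *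
        H (ω.1 l) (fun i => ω.2 i) x := by
  rw [Fintype.sum_prod_type, Fintype.sum_prod_type]
  refine Finset.sum_congr rfl fun s _ => ?_
  have h := sum_kernel_step (k := fun l => q l (s l)) (fun l v => hq l (s l) v) l (H (s l))
  simp only [jointPmf, mul_assoc, ← Finset.mul_sum, h]

theorem prob_jointPmf (hq : ∀ l s v, q l s v ∈ stdSimplex ℝ (U l)) (l : Fin L) (s : S l)
    (x : U l) (v : ∀ i : {i // i < l}, U i) :
    prob (jointPmf p q) (fun ω => (ω.1 l, ω.2 l, fun j : {j // j < l} => ω.2 j)) (s, x, v) =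
      prob (jointPmf p q) (fun ω => (ω.1 l, fun j : {j // j < l} => ω.2 j)) (s, v) *
        q l s v x := by
  classical
  have h := sum_jointPmf_step (p := p) hq l
    fun s' v' x' => if (s', x', v') = (s, x, v) then 1 else 0
  have h1 : prob (jointPmf p q) (fun ω => (ω.1 l, ω.2 l, fun j : {j // j < l} => ω.2 j))
      (s, x, v) = ∑ ω, jointPmf p q ω *
        (if (ω.1 l, ω.2 l, fun j : {j // j < l} => ω.2 j) = (s, x, v) then 1 else 0) := by
    simp only [prob, mul_ite, mul_one, mul_zero]
    exact Finset.sum_congr rfl fun ω _ => by congr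
  rw [h1, h, prob, Finset.sum_mul]
  refine Finset.sum_congr rfl fun ω _ => ?_
  by_cases hω : (ω.1 l, fun j : {j // j < l} => ω.2 j) = (s, v)
  · rw [if_pos hω]
    obtain ⟨hs, hv⟩ := Prod.mk.inj hω
    simp [hs, hv]
  · rw [if_neg hω, zero_mul]
    refine mul_eq_zero_of_right _ (Finset.sum_eq_zero fun y _ => ?_)
    rw [if_neg, mul_zero]
    intro h2
    simp only [Prod.mk.injEq] at h2
    exact hω (Prod.ext h2.1 h2.2.2)

/-- The test channels and the conditional laws of `U_l` given `U_{<l}` are positive on the support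
of the joint pmf. -/
theorem channel_pos (hp : p ∈ stdSimplex ℝ (∀ l, S l))
    (hq : ∀ l s v, q l s v ∈ stdSimplex ℝ (U l)) (l : Fin L)
    {r : (∀ i : {i // i < l}, U i) → U l → ℝ}
    (hr : ∀ v x, prob (jointPmf p q) (fun ω (j : {j // j < l}) => ω.2 j) v * r v x =
      prob (jointPmf p q) (fun ω => (ω.2 l, fun j : {j // j < l} => ω.2 j)) (x, v))
    {ω : (∀ l, S l) × (∀ l, U l)} (hω : 0 < jointPmf p q ω) :
    0 < q l (ω.1 l) (fun i => ω.2 i) (ω.2 l) ∧ 0 < r (fun i => ω.2 i) (ω.2 l) := by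
  have hQ := (jointPmf_mem_stdSimplex hp hq).1
  constructor
  · refine ((hq l _ _).1 _).lt_of_ne' fun h => hω.ne' ?_
    exact mul_eq_zero_of_right _ (Finset.prod_eq_zero (Finset.mem_univ l) h)
  · have h1 := prob_pos hQ (fun ω (j : {j // j < l}) => ω.2 j) hω
    have h2 := prob_pos hQ (fun ω => (ω.2 l, fun j : {j // j < l} => ω.2 j)) hω
    exact pos_of_mul_pos_right (by rw [hr]; exact h2) h1.le

/-- `I(S_l; U_l | U_{<l})` is the expectation of the logarithm of the density of the test channel
with respect to the conditional law `r` of `U_l` given `U_{<l}`. -/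
theorem condMutualInfo_eq (hp : p ∈ stdSimplex ℝ (∀ l, S l))
    (hq : ∀ l s v, q l s v ∈ stdSimplex ℝ (U l)) (l : Fin L)
    {r : (∀ i : {i // i < l}, U i) → U l → ℝ}
    (hr : ∀ v x, prob (jointPmf p q) (fun ω (j : {j // j < l}) => ω.2 j) v * r v x =
      prob (jointPmf p q) (fun ω => (ω.2 l, fun j : {j // j < l} => ω.2 j)) (x, v)) :
    condMutualInfo (jointPmf p q) (fun ω => ω.1 l) (fun ω => ω.2 l)
        (fun ω (j : {j // j < l}) => ω.2 j) =
      ∑ ω, jointPmf p q ω *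
        Real.logb 2 (q l (ω.1 l) (fun i => ω.2 i) (ω.2 l) / r (fun i => ω.2 i) (ω.2 l)) := by
  have hQ := (jointPmf_mem_stdSimplex hp hq).1
  refine Finset.sum_congr rfl fun ω _ => ?_
  rcases (hQ ω).eq_or_lt with h | h
  · rw [← h, zero_mul, zero_mul]
  · have h1 := prob_pos hQ (fun ω => (ω.1 l, fun j : {j // j < l} => ω.2 j)) h
    have h2 := prob_pos hQ (fun ω (j : {j // j < l}) => ω.2 j) h
    have h3 := (channel_pos hp hq l hr h).2
    congr 2
    rw [prob_jointPmf hq, ← hr]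
    have h1' := h1.ne'
    have h2' := h2.ne'
    have h3' := h3.ne'
    field_simp

theorem condMutualInfo_nonneg (hp : p ∈ stdSimplex ℝ (∀ l, S l))
    (hq : ∀ l s v, q l s v ∈ stdSimplex ℝ (U l)) (l : Fin L)
    {r : (∀ i : {i // i < l}, U i) → U l → ℝ} (hr1 : ∀ v, r v ∈ stdSimplex ℝ (U l))
    (hr : ∀ v x, prob (jointPmf p q) (fun ω (j : {j // j < l}) => ω.2 j) v * r v x =
      prob (jointPmf p q) (fun ω => (ω.2 l, fun j : {j // j < l} => ω.2 j)) (x, v)) :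
    0 ≤ condMutualInfo (jointPmf p q) (fun ω => ω.1 l) (fun ω => ω.2 l)
      (fun ω (j : {j // j < l}) => ω.2 j) := by
  have hQ := jointPmf_mem_stdSimplex hp hq
  rw [condMutualInfo_eq hp hq l hr]
  -- `log t ≥ 1 - 1/t`, and the expectation of `r / q` is at most `1`
  have hle : ∑ ω, jointPmf p q ω *
      (r (fun i => ω.2 i) (ω.2 l) / q l (ω.1 l) (fun i => ω.2 i) (ω.2 l)) ≤ 1 := by
    rw [sum_jointPmf_step hq l fun s v x => r v x / q l s v x, ← hQ.2]
    refine Finset.sum_le_sum fun ω _ => mul_le_of_le_one_right (hQ.1 ω) ?_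
    rw [← (hr1 fun i => ω.2 i).2]
    refine Finset.sum_le_sum fun x _ => ?_
    rcases eq_or_ne (q l (ω.1 l) (fun i => ω.2 i) x) 0 with h | h
    · rw [h, zero_mul]
      exact (hr1 _).1 x
    · rw [mul_div_cancel₀ _ h]
  have hlog : 0 ≤ ∑ ω, jointPmf p q ω *
      Real.log (q l (ω.1 l) (fun i => ω.2 i) (ω.2 l) / r (fun i => ω.2 i) (ω.2 l)) := by
    calc (0 : ℝ) ≤ ∑ ω, jointPmf p q ω * (1 -
          r (fun i => ω.2 i) (ω.2 l) / q l (ω.1 l) (fun i => ω.2 i) (ω.2 l)) := by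
          simp only [mul_sub, mul_one, Finset.sum_sub_distrib, hQ.2]
          linarith
      _ ≤ _ := by
          refine Finset.sum_le_sum fun ω _ => ?_
          rcases (hQ.1 ω).eq_or_lt with h | h
          · rw [← h, zero_mul, zero_mul]
          · obtain ⟨h1, h2⟩ := channel_pos hp hq l hr h
            have h3 := Real.one_sub_inv_le_log_of_pos (div_pos h1 h2)
            rw [inv_div] at h3
            exact mul_le_mul_of_nonneg_left h3 h.le
  simp only [Real.logb, ← mul_div_assoc, ← Finset.sum_div]
  exact div_nonneg hlog (Real.log_nonneg one_le_two)

end TestChannel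

/-! ### Block coding with the test channels -/

section Block

variable {L : ℕ} {S : Fin L → Type*} {U : Fin L → Type*} {p : (∀ l, S l) → ℝ}
  {q : (l : Fin L) → S l → (∀ i : {i // i < l}, U i) → U l → ℝ}

theorem prod_jointPmf (n : ℕ) (ω : Fin n → (∀ l, S l) × (∀ l, U l)) :
    (∏ i, p (ω i).1) * ∏ l, ∏ i, q l ((ω i).1 l) (fun j => (ω i).2 j) ((ω i).2 l) =
      ∏ i, jointPmf p q (ω i) := by
  rw [Finset.prod_comm, ← Finset.prod_mul_distrib]
  rfl

variable [∀ l, Fintype (U l)]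

theorem nonempty_of_channels {s : ∀ l, S l} (hq : ∀ l s v, q l s v ∈ stdSimplex ℝ (U l)) :
    Nonempty (∀ l, U l) := by
  have h : ∀ l, (∀ i : {i // i < l}, U i) → Nonempty (U l) := fun l v => by
    by_contra hne
    rw [not_nonempty_iff] at hne
    simpa using (hq l (s l) v).2
  exact ⟨assemble fun l v => (h l v).some⟩

variable [∀ l, Fintype (S l)]

/-- A sum over blocks of source symbols and blocks of letters of all terminals is a sum over
blocks of joint symbols. -/
theorem sum_block (n : ℕ) (H : (Fin n → ∀ l, S l) → (∀ l, Fin n → U l) → ℝ) :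
    ∑ s, ∑ u, H s u = ∑ ω : Fin n → (∀ l, S l) × (∀ l, U l),
      H (fun i => (ω i).1) fun l i => (ω i).2 l := by
  let e : (Fin n → (∀ l, S l) × (∀ l, U l)) ≃ (Fin n → ∀ l, S l) × (∀ l, Fin n → U l) :=
    { toFun := fun ω => (fun i => (ω i).1, fun l i => (ω i).2 l)
      invFun := fun y i => (y.1 i, fun l => y.2 l i)
      left_inv := fun _ => rfl
      right_inv := fun _ => rfl }
  rw [← Fintype.sum_prod_type', ← e.sum_comp]
  rfl

open Classical in
/-- For long blocks the densities of the test channels exceed the exponentials of their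
expectations only with a small probability. -/
theorem exists_block_density_bound (hp : p ∈ stdSimplex ℝ (∀ l, S l))
    (hq : ∀ l s v, q l s v ∈ stdSimplex ℝ (U l))
    {r : ∀ l, (∀ i : {i // i < l}, U i) → U l → ℝ}
    (hr : ∀ l v x, prob (jointPmf p q) (fun ω (j : {j // j < l}) => ω.2 j) v * r l v x =
      prob (jointPmf p q) (fun ω => (ω.2 l, fun j : {j // j < l} => ω.2 j)) (x, v))
    {ρ : Fin L → ℝ} (hρ : ∀ l, condMutualInfo (jointPmf p q) (fun ω => ω.1 l) (fun ω => ω.2 l)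
      (fun ω (j : {j // j < l}) => ω.2 j) < ρ l) :
    ∃ c : Fin L → ℝ, (∀ l, 0 ≤ c l ∧ c l < 1) ∧ ∀ n : ℕ, 1 - ∑ l, c l ^ n ≤
      ∑ ω : Fin n → (∀ l, S l) × (∀ l, U l),
        if ∀ l, ∏ i, q l ((ω i).1 l) (fun j => (ω i).2 j) ((ω i).2 l) ≤
          (2 : ℝ) ^ (n * ρ l) * ∏ i, r l (fun j => (ω i).2 j) ((ω i).2 l) then
        ∏ i, jointPmf p q (ω i) else 0 := by
  have hQ := jointPmf_mem_stdSimplex hp hq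
  let Y : Fin L → (∀ l, S l) × (∀ l, U l) → ℝ := fun l ω =>
    Real.logb 2 (q l (ω.1 l) (fun i => ω.2 i) (ω.2 l) / r l (fun i => ω.2 i) (ω.2 l)) - ρ l
  have hY : ∀ l, ∑ ω, jointPmf p q ω * Y l ω < 0 := fun l => by
    simp only [Y, mul_sub, Finset.sum_sub_distrib, ← Finset.sum_mul, hQ.2, one_mul]
    rw [← condMutualInfo_eq hp hq l (hr l)]
    linarith [hρ l]
  choose c hc0 hc1 hc using fun l => exists_large_deviation_bound hQ (Y l) (hY l)
  refine ⟨c, fun l => ⟨hc0 l, hc1 l⟩, fun n => ?_⟩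
  rw [sub_le_iff_le_add, ← (prod_mem_stdSimplex fun _ : Fin n => hQ).2]
  refine le_trans ?_ (add_le_add_right (Finset.sum_le_sum fun l _ => hc l n) _)
  rw [Finset.sum_comm, ← Finset.sum_add_distrib]
  refine Finset.sum_le_sum fun ω _ => ?_
  have hprod : 0 ≤ ∏ i, jointPmf p q (ω i) := Finset.prod_nonneg fun i _ => hQ.1 _
  have hterm : ∀ l ∈ Finset.univ, 0 ≤ if 0 < ∑ i, Y l (ω i) then ∏ i, jointPmf p q (ω i) else 0 :=
    fun l _ => by split_ifs; exacts [hprod, le_rfl]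
  split_ifs with hgood
  · exact le_add_of_nonneg_right (Finset.sum_nonneg hterm)
  · rw [zero_add]
    rcases hprod.eq_or_lt with h0 | hpos
    · rw [← h0]
      simp
    · have hω : ∀ i, 0 < jointPmf p q (ω i) := fun i => (hQ.1 _).lt_of_ne' fun h =>
        hpos.ne' (Finset.prod_eq_zero (Finset.mem_univ i) h)
      simp only [not_forall, not_le] at hgood
      obtain ⟨l, hl⟩ := hgood
      have hch := fun i => channel_pos hp hq l (hr l) (hω i)
      have hsum : 0 < ∑ i, Y l (ω i) := by
        have hr0 : 0 < ∏ i, r l (fun j => (ω i).2 j) ((ω i).2 l) :=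
          Finset.prod_pos fun i _ => (hch i).2
        simp only [Y, Finset.sum_sub_distrib, Finset.sum_const, Finset.card_univ,
          Fintype.card_fin, nsmul_eq_mul, sub_pos]
        rw [← Real.logb_prod _ _ fun i _ => (div_pos (hch i).1 (hch i).2).ne',
          Finset.prod_div_distrib,
          Real.lt_logb_iff_rpow_lt one_lt_two (div_pos (Finset.prod_pos fun i _ => (hch i).1) hr0),
          lt_div_iff₀ hr0]
        exact hl
      refine le_trans ?_ (Finset.single_le_sum hterm (Finset.mem_univ l))
      rw [if_pos hsum]

/-- `K ≥ Γ * 2 ^ x` independent tries of success probability `1 / Γ` fail with probability at most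
`2 ^ (-x)`. -/
theorem one_sub_inv_pow_le {Γ x : ℝ} (hΓ : 1 ≤ Γ) {K : ℕ} (hK : Γ * 2 ^ x ≤ K) :
    (1 - Γ⁻¹) ^ K ≤ ((2 : ℝ) ^ x)⁻¹ := by
  have hΓ0 : 0 < Γ := by linarith
  have h2 : (0 : ℝ) < 2 ^ x := by positivity
  calc (1 - Γ⁻¹) ^ K ≤ (Real.exp (-Γ⁻¹)) ^ K :=
        pow_le_pow_left₀ (sub_nonneg.2 (inv_le_one_of_one_le₀ hΓ)) (Real.one_sub_le_exp_neg _) K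
    _ = (Real.exp (K * Γ⁻¹))⁻¹ := by rw [← Real.exp_nat_mul, ← Real.exp_neg]; ring_nf
    _ ≤ ((2 : ℝ) ^ x)⁻¹ := by
        refine inv_anti₀ h2 ?_
        have h3 : (2 : ℝ) ^ x ≤ K * Γ⁻¹ := by
          rw [← div_eq_mul_inv, le_div_iff₀' hΓ0]; exact hK
        linarith [Real.add_one_le_exp (K * Γ⁻¹)]

end Block

open RoutingScheme in
/-- For all large block lengths there is a routing scheme whose rates are close to the information
rates and whose distortion is close to that of the test channels. -/
theorem exists_routingScheme {L : ℕ} {S : Fin L → Type*} [∀ l, Fintype (S l)] {Z Zhat : Type*}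
    {p : (∀ l, S l) → ℝ} (hp : p ∈ stdSimplex ℝ (∀ l, S l)) (φ : (∀ l, S l) → Z)
    {d : Z → Zhat → ℝ} (hd : ∀ z zhat, 0 ≤ d z zhat) {D : ℝ} {R : Fin L → ℝ}
    (hR : R ∈ irRegion p φ d D) {ε : ℝ} (hε : 0 < ε) :
    ∃ N : ℕ, ∀ n ≥ N, ∃ σ : RoutingScheme S Zhat n,
      (∀ l, ∑ i ∈ Finset.Iic l, Real.logb 2 (σ.size i) ≤ n * (R l + ε)) ∧
      σ.totalDistortion p φ d ≤ n * (D + ε) := by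
  classical
  obtain ⟨U, _, q, g, hq, hD, hI⟩ := hR
  have hQ := jointPmf_mem_stdSimplex hp hq
  obtain ⟨s₀⟩ : Nonempty (∀ l, S l) := by
    by_contra h
    rw [not_nonempty_iff] at h
    simpa using hp.2
  obtain ⟨u₀⟩ := nonempty_of_channels (s := s₀) hq
  have hU : ∀ l, Nonempty (U l) := fun l => ⟨u₀ l⟩
  choose r hr1 hr using fun l => exists_condKernel hQ.1
    (fun ω : (∀ l, S l) × (∀ l, U l) => ω.2 l) (fun ω (j : {j // j < l}) => ω.2 j)
  set I : Fin L → ℝ := fun l => condMutualInfo (jointPmf p q) (fun ω => ω.1 l) (fun ω => ω.2 l)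
    (fun ω (j : {j // j < l}) => ω.2 j) with hIdef
  have hI0 : ∀ l, 0 ≤ I l := fun l => condMutualInfo_nonneg hp hq l (hr1 l) (hr l)
  set η : ℝ := ε / (3 * (L + 1)) with hη
  have hη0 : 0 < η := by positivity
  obtain ⟨c, hc, hgood⟩ := exists_block_density_bound hp hq hr (ρ := fun l => I l + η)
    fun l => by simp only [hIdef]; linarith
  obtain ⟨C, hC0, hC⟩ : ∃ C : ℝ, 0 ≤ C ∧ ∀ s u, d (φ s) (g u) ≤ C := by
    refine ⟨∑ ω : (∀ l, S l) × (∀ l, U l), d (φ ω.1) (g ω.2),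
      Finset.sum_nonneg fun _ _ => hd _ _, fun s u => ?_⟩
    exact Finset.single_le_sum (f := fun ω : (∀ l, S l) × (∀ l, U l) => d (φ ω.1) (g ω.2))
      (fun _ _ => hd _ _) (Finset.mem_univ (s, u))
  -- the loss in distortion vanishes: `a ^ n` bounds the failure probability of the samplers
  set a : ℝ := ((2 : ℝ) ^ η)⁻¹ with ha
  have h2η : 1 < (2 : ℝ) ^ η := Real.one_lt_rpow one_lt_two hη0
  have ha0 : 0 ≤ a := by positivity
  have ha1 : a < 1 := inv_lt_one_of_one_lt₀ h2η
  have hlim : Filter.Tendsto (fun n : ℕ => C * (1 - (1 - a ^ n) ^ L * (1 - ∑ l, c l ^ n)))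
      Filter.atTop (nhds 0) := by
    have h1 := tendsto_pow_atTop_nhds_zero_of_lt_one ha0 ha1
    have h2 : Filter.Tendsto (fun n : ℕ => ∑ l, c l ^ n) Filter.atTop (nhds 0) := by
      simpa using tendsto_finsetSum Finset.univ fun l _ =>
        tendsto_pow_atTop_nhds_zero_of_lt_one (hc l).1 (hc l).2
    have h3 := (((h1.const_sub 1).pow L).mul (h2.const_sub 1)).const_sub 1 |>.const_mul C
    simpa using h3
  obtain ⟨N, hN⟩ := Filter.eventually_atTop.1 (hlim.eventually_lt_const hε)
  refine ⟨max N ⌈2 / η⌉₊, fun n hn => ?_⟩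
  have hnN : N ≤ n := (le_max_left _ _).trans hn
  have hn2 : 2 ≤ n * η := by
    rw [← div_le_iff₀ hη0]
    exact (Nat.le_ceil _).trans (by exact_mod_cast (le_max_right _ _).trans hn)
  have hpow : (2 : ℝ) ^ (n * η) = (2 ^ η) ^ n := by
    rw [mul_comm, Real.rpow_mul zero_le_two, Real.rpow_natCast]
  set Γ : Fin L → ℝ := fun l => 2 ^ (n * (I l + η)) with hΓ
  have hΓ1 : ∀ l, 1 ≤ Γ l := fun l => Real.one_le_rpow one_le_two
    (mul_nonneg n.cast_nonneg (add_nonneg (hI0 l) hη0.le))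
  set K : Fin L → ℕ := fun l => ⌈Γ l * 2 ^ (n * η)⌉₊ with hK
  have hKa : ∀ l, (1 - (Γ l)⁻¹) ^ K l ≤ a ^ n := fun l => by
    rw [ha, inv_pow, ← hpow]
    exact one_sub_inv_pow_le (hΓ1 l) (Nat.le_ceil _)
  obtain ⟨f, b, hfb⟩ := exists_cascade_le (B := fun l => Fin n → U l)
    (prod_mem_stdSimplex fun _ : Fin n => hp)
    (fun l (s : Fin n → ∀ l, S l) i => s i l)
    (q := fun l x v y => ∏ i, q l (x i) (fun j => v j i) (y i))
    (fun l x v => prod_mem_stdSimplex fun i => hq l (x i) fun j => v j i)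
    (r := fun l v y => ∏ i, r l (fun j => v j i) (y i))
    (fun l v => prod_mem_stdSimplex fun i => hr1 l fun j => v j i)
    hΓ1 (pow_nonneg ha0 n) (pow_le_one₀ ha0 ha1.le) hKa
    (F := fun s u => ∑ i, d (φ (s i)) (g fun l => u l i)) (C := n * C)
    (fun s u => Finset.sum_nonneg fun i _ => hd _ _)
    (fun s u => by simpa using Finset.sum_le_card_nsmul Finset.univ _ C fun i _ => hC (s i) _)
  obtain ⟨σ, hσ, hdec⟩ := exists_of_codebooks (B := fun l => Fin n → U l)
    (size := fun l => K l + 1) (fun l => Nat.succ_pos (K l)) f b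
    (fun u i => g fun l => u l i)
  refine ⟨σ, fun l => ?_, ?_⟩
  · have hsize : ∀ i, Real.logb 2 (σ.size i) ≤ n * (I i + 3 * η) := fun i => by
      have h1 : (0 : ℝ) < K i + 1 := by positivity
      -- the block length is so large that `n * η` bits absorb the rounding in `K` and the dummy index
      have h4 : (4 : ℝ) ≤ 2 ^ (n * η) := by
        have := Real.rpow_le_rpow_of_exponent_le one_le_two hn2
        norm_num at this
        exact this
      have h5 : (K i : ℝ) < Γ i * 2 ^ (n * η) + 1 := Nat.ceil_lt_add_one (by positivity)
      have h6 : 1 ≤ Γ i * 2 ^ (n * η) := one_le_mul_of_one_le_of_one_le (hΓ1 i) (by linarith)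
      have h7 : (2 : ℝ) ^ (n * (I i + 3 * η)) = Γ i * 2 ^ (n * η) * 2 ^ (n * η) := by
        rw [hΓ, ← Real.rpow_add two_pos, ← Real.rpow_add two_pos]
        ring_nf
      rw [hσ, Nat.cast_succ, Real.logb_le_iff_le_rpow one_lt_two h1, h7]
      nlinarith
    have hcard : ((Finset.Iic l).card : ℝ) ≤ L + 1 := by
      have := Finset.card_le_univ (Finset.Iic l)
      rw [Fintype.card_fin] at this
      have h : ((Finset.Iic l).card : ℝ) ≤ L := by exact_mod_cast this
      linarith
    calc ∑ i ∈ Finset.Iic l, Real.logb 2 (σ.size i)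
        ≤ ∑ i ∈ Finset.Iic l, n * (I i + 3 * η) := Finset.sum_le_sum fun i _ => hsize i
      _ = n * (∑ i ∈ Finset.Iic l, I i + (Finset.Iic l).card * (3 * η)) := by
          rw [← Finset.mul_sum, Finset.sum_add_distrib, Finset.sum_const, nsmul_eq_mul]
      _ ≤ n * (R l + ε) := by
          have h3 : (L + 1 : ℝ) * (3 * η) = ε := by
            rw [hη]; field_simp
          have h4 : ((Finset.Iic l).card : ℝ) * (3 * η) ≤ (L + 1) * (3 * η) := by gcongr
          gcongr
          · exact hI l
          · linarith
  · -- the distortion under the law generated by the test channels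
    have hmean : ∑ s : Fin n → ∀ l, S l, ∑ u : ∀ l, Fin n → U l, (∏ i, p (s i)) *
        (∏ l, ∏ i, q l (s i l) (fun j => u j i) (u l i)) * ∑ i, d (φ (s i)) (g fun l => u l i) =
        n * ∑ ω, jointPmf p q ω * d (φ ω.1) (g ω.2) := by
      rw [sum_block n fun s u => (∏ i, p (s i)) *
        (∏ l, ∏ i, q l (s i l) (fun j => u j i) (u l i)) * ∑ i, d (φ (s i)) (g fun l => u l i)]
      simp only [prod_jointPmf]
      simp only [Finset.mul_sum]
      rw [Finset.sum_comm]
      have h := fun i : Fin n => sum_prod_apply (fun _ : Fin n => hQ) i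
        fun ω => d (φ ω.1) (g ω.2)
      simp only [h, Finset.sum_const, Finset.card_univ, Fintype.card_fin, nsmul_eq_mul,
        Finset.mul_sum]
    have hgood' : 1 - ∑ l, c l ^ n ≤ ∑ s : Fin n → ∀ l, S l, ∑ u : ∀ l, Fin n → U l,
        if ∀ l, ∏ i, q l (s i l) (fun j => u j i) (u l i) ≤
          Γ l * ∏ i, r l (fun j => u j i) (u l i) then
        (∏ i, p (s i)) * ∏ l, ∏ i, q l (s i l) (fun j => u j i) (u l i) else 0 := by
      rw [sum_block n fun s u => if ∀ l, ∏ i, q l (s i l) (fun j => u j i) (u l i) ≤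
          Γ l * ∏ i, r l (fun j => u j i) (u l i) then
        (∏ i, p (s i)) * ∏ l, ∏ i, q l (s i l) (fun j => u j i) (u l i) else 0]
      simp only [prod_jointPmf]
      refine (hgood n).trans_eq (Finset.sum_congr rfl fun ω _ => ?_)
      congr
    have hloss := hN n hnN
    have hpow0 : 0 ≤ (1 - a ^ n) ^ L := pow_nonneg (sub_nonneg.2 (pow_le_one₀ ha0 ha1.le)) _
    have htot : σ.totalDistortion p φ d = ∑ s : Fin n → ∀ l, S l, (∏ i, p (s i)) *
        ∑ i, d (φ (s i)) (g fun l => assemble (fun l v => b l v (f l (fun i => s i l) v)) l i) := by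
      simp only [totalDistortion, hdec]
    rw [htot]
    refine hfb.trans ?_
    rw [hmean]
    have h1 := mul_le_mul_of_nonneg_left hgood' hpow0
    have hn0 : (0 : ℝ) ≤ n := n.cast_nonneg
    have h2 := mul_le_mul_of_nonneg_left (sub_le_sub_left h1 1) (mul_nonneg hn0 hC0)
    have h3 := mul_le_mul_of_nonneg_left hloss.le hn0
    have h4 := mul_le_mul_of_nonneg_left hD hn0
    refine (add_le_add h4 ?_).trans_eq (mul_add _ _ _).symm
    refine (le_of_eq ?_).trans (h2.trans (by rw [mul_assoc]; exact h3))
    congr!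

end Cascade

/-! ### Achievability of the region -/

open Cascade RoutingScheme in
theorem theorem1 {L : ℕ} {S : Fin L → Type*} [∀ l, Fintype (S l)] {Z Zhat : Type*}
    (p : (∀ l, S l) → ℝ) (hp : p ∈ stdSimplex ℝ (∀ l, S l))
    (φ : (∀ l, S l) → Z) (d : Z → Zhat → ℝ) (hd : ∀ z zhat, 0 ≤ d z zhat) (D : ℝ) :
    Cascade.irRegion p φ d D ⊆ Cascade.routingAchievable p φ d D ∧
    ((∃ h : (∀ l, S l) → Zhat, ∑ s, p s * d (φ s) (h s) < D) →
      Cascade.irRegion p φ d D ⊆ closure (Cascade.routingRates p φ d D)) := by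
  refine ⟨fun R hR ε hε => ?_, ?_⟩
  · obtain ⟨N, hN⟩ := exists_routingScheme hp φ hd hR hε
    refine ⟨max N 1, fun n hn => ?_⟩
    have hn0 : 0 < n := (le_max_right N 1).trans hn
    obtain ⟨σ, hrate, hdist⟩ := hN n ((le_max_left _ _).trans hn)
    refine ⟨σ.toCode, σ.isRouting_toCode, σ.ratesLE_toCode hn0 hrate, ?_⟩
    rw [σ.expDistortion_toCode, div_le_iff₀' (by exact_mod_cast hn0)]
    exact hdist
  · rintro ⟨h, hh⟩ R hR
    obtain ⟨s₀⟩ : Nonempty (∀ l, S l) := by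
      by_contra h
      rw [not_nonempty_iff] at h
      simpa using hp.2
    have hS : ∀ l, Nonempty (S l) := fun l => ⟨s₀ l⟩
    rw [Metric.mem_closure_iff]
    intro δ hδ
    set D₀ := ∑ s, p s * d (φ s) (h s)
    set B : Fin L → ℝ := fun l => ∑ i ∈ Finset.Iic l, Real.logb 2 (Fintype.card (S i)) with hB
    -- a lossless scheme of length `m` corrects the distortion of a scheme of length `t * m`, with
    -- `t` so large that the rates are hardly affected
    obtain ⟨t, ht⟩ := exists_nat_gt (max 0 ((∑ l, |B l - R l|) / (δ / 4)))
    have ht0 : (0 : ℝ) < t := (le_max_left _ _).trans_lt ht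
    have htB : ∀ l, B l - R l ≤ t * (δ / 4) := fun l => by
      have h1 := (div_lt_iff₀ (by positivity)).1 ((le_max_right _ _).trans_lt ht)
      have h2 := Finset.single_le_sum (f := fun l => |B l - R l|) (fun l _ => abs_nonneg _)
        (Finset.mem_univ l)
      exact (le_abs_self _).trans (h2.trans h1.le)
    obtain ⟨N, hN⟩ := exists_routingScheme hp φ hd hR
      (ε := min (δ / 4) ((D - D₀) / t)) (lt_min (by positivity) (div_pos (sub_pos.2 hh) ht0))
    set ε := min (δ / 4) ((D - D₀) / t)
    have ht1 : 1 ≤ t := by exact_mod_cast ht0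
    obtain ⟨m, hm0, hmN⟩ : ∃ m, 0 < m ∧ N ≤ t * m := ⟨N + 1, N.succ_pos, by nlinarith⟩
    obtain ⟨σ, hrate, hdist⟩ := hN (t * m) hmN
    have hm : (0 : ℝ) < m := by exact_mod_cast hm0
    have hpos : 0 < t * m + m := by positivity
    refine ⟨fun l => R l + δ / 2, ⟨t * m + m, hpos, (σ.concat (lossless h m)).toCode,
      isRouting_toCode _, ratesLE_toCode _ hpos fun l => ?_, ?_⟩, ?_⟩
    · have hsum : ∑ i ∈ Finset.Iic l, Real.logb 2 ((σ.concat (lossless h m)).size i) =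
          ∑ i ∈ Finset.Iic l, Real.logb 2 (σ.size i) + m * B l := by
        rw [hB, Finset.mul_sum, ← Finset.sum_add_distrib]
        refine Finset.sum_congr rfl fun i _ => ?_
        rw [← logb_size_lossless h, ← Real.logb_mul
          (by exact_mod_cast (σ.size_pos i).ne')
          (by exact_mod_cast ((lossless h m).size_pos i).ne'), ← Nat.cast_mul]
        rfl
      have h1 := hrate l
      have h2 := mul_le_mul_of_nonneg_left (htB l) hm.le
      have h3 : (t * m : ℝ) * ε ≤ t * m * (δ / 4) := by
        gcongr
        exact min_le_left _ _
      rw [hsum]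
      push_cast at h1 ⊢
      nlinarith [mul_pos hm hδ]
    · rw [expDistortion_toCode, totalDistortion_concat _ _ hp, totalDistortion_lossless h hp,
        div_le_iff₀' (by exact_mod_cast hpos)]
      have h1 : t * ε ≤ D - D₀ := by
        rw [← le_div_iff₀' ht0]
        exact min_le_right _ _
      have h2 := mul_le_mul_of_nonneg_left h1 hm.le
      push_cast at hdist ⊢
      nlinarith
    · refine (dist_pi_lt_iff hδ).2 fun l => ?_
      rw [Real.dist_eq, sub_add_cancel_left, abs_neg, abs_of_pos (by positivity)]
      linarith
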